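/- Let $1\le \tau\le n$ and $K\ge 1$ be integers. Let $B$ be an $n\times n$ real symmetric positive definite matrix with eigenvalues $\lambda_1\ge\dots\ge\lambda_n$ and spectral decomposition $B=Q\,\mathrm{Diag}(\lambda_1,\dots,\lambda_n)\,Q^T$, where $Q$ is orthogonal, and let $$B_\tau := Q\,\mathrm{Diag}(\lambda_1,\dots,\lambda_\tau,\lambda_\tau,\dots,\lambda_\tau)\,Q^T+\Big(\sum_{i=\tau+1}^n\lambda_i\Big) I .$$ For a symmetric positive semidefinite matrix $A$ write $\|v\|_A:=\langle Av,v\rangle^{1/2}$. Let $f:\mathbb R^n\to\mathbb R$ be a differentiable function that is 1-smooth with respect to $\|\cdot\|_B$, i.e. $$f(y)\le f(x)+\langle\nabla f(x),y-x\rangle+\tfrac12\|y-x\|_B^2\qquad\text{for all }x,y\in\mathbb R^n,$$ and strongly convex with respect to $\|\cdot\|_{B_\tau}$ with constant $\mu_\tau>0$, i.e. $$f(y)\ge f(x)+\langle\nabla f(x),y-x\rangle+\tfrac{\mu_\tau}2\|y-x\|_{B_\tau}^2\qquad\text{for all }x,y\in\mathbb R^n$$ (for instance, with $\mu_\tau$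 the largest such constant). Let $x_0\in\mathbb R^n$ be deterministic, and let $x_1,\dots,x_K$ be the random points generated by the randomized coordinate descent method with volume sampling (RCDVS): $$x_{k+1}=x_k-I_{S_k}(B_{S_k\times S_k})^{-1}\nabla f(x_k)_{S_k},\qquad 0\le k\le K-1,$$ where $S_0,\dots,S_{K-1}$ are independent random $\tau$-element subsets of $\{1,\dots,n\}$ with $$\Pr(S_k=S)=\frac{\det B_{S\times S}}{\sum_{|S'|=\tau}\det B_{S'\times S'}}\qquad\text{for every }\tau\text{-element } S\subseteq\{1,\dots,n\}.$$ Here $B_{S\times S}$ is the principal submatrix of $B$ with rows and columns in $S$, $v_S$ is the subvector of $v$ with entries in $S$, and $I_S$ is the $n\times\tau$ matrix formed by the columns of the identity matrix with indices in $S$. Then $f$ attains its minimum, each $f(x_k)$ is integrable, and $$\mathbb E f(x_k)-\min f\le(1-\mu_\tau)^k\,(f(x_0)-\min f)\qquad\text{for all }0\le k\le K.$$ -/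

import Mathlib

open MeasureTheory ProbabilityTheory

noncomputable section

namespace RCDVS

/-- The (semi)norm `‖v‖_A = ⟨A v, v⟩^{1/2}` on `ℝⁿ` induced by a symmetric positive
semidefinite matrix `A`. -/
def matNorm {n : ℕ} (A : Matrix (Fin n) (Fin n) ℝ) (v : EuclideanSpace ℝ (Fin n)) : ℝ :=
  Real.sqrt ((A.mulVec v.ofLp) ⬝ᵥ v.ofLp)

/-- `f` is differentiable and 1-smooth with respect to `‖·‖_B`. -/
def IsOneSmooth {n : ℕ} (B : Matrix (Fin n) (Fin n) ℝ)
    (f : EuclideanSpace ℝ (Fin n) → ℝ) : Prop :=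
  Differentiable ℝ f ∧
    ∀ x y, f y ≤ f x + inner ℝ (gradient f x) (y - x) + 1 / 2 * matNorm B (y - x) ^ 2

/-- `f` is differentiable and strongly convex with respect to `‖·‖_A` with constant `m > 0`. -/
def IsStronglyConvex {n : ℕ} (A : Matrix (Fin n) (Fin n) ℝ) (m : ℝ)
    (f : EuclideanSpace ℝ (Fin n) → ℝ) : Prop :=
  Differentiable ℝ f ∧ 0 < m ∧
    ∀ x y, f x + inner ℝ (gradient f x) (y - x) + m / 2 * matNorm A (y - x) ^ 2 ≤ f y

/-- `B = Q Diag(lam) Qᵀ` is a spectral decomposition of `B` with `Q` orthogonal and with the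
eigenvalues listed in non-increasing order. -/
structure IsSpectralDecomposition {n : ℕ} (B Q : Matrix (Fin n) (Fin n) ℝ)
    (lam : Fin n → ℝ) : Prop where
  orthogonal : Q ∈ Matrix.orthogonalGroup (Fin n) ℝ
  antitone : Antitone lam
  decomposition : B = Q * Matrix.diagonal lam * Q.transpose

/-- The `τ`-coordinate approximation (for `1 ≤ τ ≤ n`)
`B_τ = Q Diag(λ₁, …, λ_τ, λ_τ, …, λ_τ) Qᵀ + (∑_{i > τ} λ_i) I` of `B = Q Diag(λ) Qᵀ`.
The indices in `Fin n` start from `0`, so `λ_τ` is `lam (τ - 1)`. -/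
def coordApprox {n : ℕ} (Q : Matrix (Fin n) (Fin n) ℝ) (lam : Fin n → ℝ) (τ : ℕ) :
    Matrix (Fin n) (Fin n) ℝ :=
  Q * Matrix.diagonal
      (fun i : Fin n => lam ⟨min i.val (τ - 1), lt_of_le_of_lt (min_le_left _ _) i.isLt⟩) *
      Q.transpose
    + (∑ i : Fin n with τ ≤ i.val, lam i) • (1 : Matrix (Fin n) (Fin n) ℝ)

/-- The collection of all `τ`-element subsets of the set of `n` coordinates. -/
abbrev CoordSet (n τ : ℕ) : Type := {S : Finset (Fin n) // S.card = τ}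

/-- The discrete `σ`-algebra on the (finite) collection of `τ`-element subsets. -/
instance (n τ : ℕ) : MeasurableSpace (CoordSet n τ) := ⊤

/-- The principal submatrix `B_{S × S}`. -/
def principal {n : ℕ} (B : Matrix (Fin n) (Fin n) ℝ) (S : Finset (Fin n)) : Matrix S S ℝ :=
  B.submatrix (fun i : S => (i : Fin n)) (fun i : S => (i : Fin n))

/-- The matrix `I_S`: the columns of the identity matrix whose indices are in `S`. -/
def colSelect {n : ℕ} (S : Finset (Fin n)) : Matrix (Fin n) S ℝ :=
  (1 : Matrix (Fin n) (Fin n) ℝ).submatrix id (fun i : S => (i : Fin n))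

/-- One iteration `x - I_S (B_{S × S})⁻¹ ∇f(x)_S`. -/
def step {n : ℕ} (f : EuclideanSpace ℝ (Fin n) → ℝ) (B : Matrix (Fin n) (Fin n) ℝ)
    (S : Finset (Fin n)) (x : EuclideanSpace ℝ (Fin n)) : EuclideanSpace ℝ (Fin n) :=
  x - WithLp.toLp 2
    ((colSelect S).mulVec ((principal B S)⁻¹.mulVec (fun i : S => gradient f x (i : Fin n))))

/-- `S ∼ Vol_τ(B)`: the random `τ`-element subset `S` is generated by `τ`-element volume
sampling with respect to `B`. -/
def IsVolumeSampling {n τ : ℕ} (B : Matrix (Fin n) (Fin n) ℝ) {Ω : Type*} [MeasurableSpace Ω]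
    (P : Measure Ω) (S : Ω → CoordSet n τ) : Prop :=
  Measurable S ∧
    ∀ T : CoordSet n τ, P.real {ω | S ω = T} =
      (principal B T.val).det / ∑ T' : CoordSet n τ, (principal B T'.val).det

/-- `x 0, …, x K` are the random points generated by the method `RCDVS(f, B, τ, x0, K)` with the
freshly drawn (mutually independent) random coordinate subsets `S 0, …, S (K - 1)`. -/
structure IsRCDVS {n τ K : ℕ} (f : EuclideanSpace ℝ (Fin n) → ℝ)
    (B : Matrix (Fin n) (Fin n) ℝ) (x0 : EuclideanSpace ℝ (Fin n))
    {Ω : Type*} [MeasurableSpace Ω] (P : Measure Ω)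
    (S : Fin K → Ω → CoordSet n τ) (x : Fin (K + 1) → Ω → EuclideanSpace ℝ (Fin n)) : Prop where
  sampling : ∀ k, IsVolumeSampling B P (S k)
  indep : iIndepFun S P
  init : ∀ ω, x 0 ω = x0
  next : ∀ (k : Fin K) (ω : Ω), x k.succ ω = step f B (S k ω).val (x k.castSucc ω)

end RCDVS

end

/-!
The argument is a Polyak–Łojasiewicz estimate in expectation. Smoothness bounds the decrease of `f`
along the coordinates `S` from below by `½ ⟨(B_{S×S})⁻¹ g_S, g_S⟩`, with `g = ∇f(x)`, and strong
convexity gives `μ_τ (f(x) - min f) ≤ ½ ⟨B_τ⁻¹ g, g⟩`. It remains to show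
`E ⟨(B_{S×S})⁻¹ g_S, g_S⟩ ≥ ⟨B_τ⁻¹ g, g⟩` under volume sampling.

Volume sampling cancels the determinants in the inverses. By the matrix determinant lemma the
remaining sum is the change of the sum of the principal minors of order `τ` when `B` is replaced by
`B + g gᵀ`, and that sum is a coefficient of the characteristic polynomial. Hence both sides may be
rotated to the eigenbasis of `B`, where the claim becomes
`e_τ(λ) ≤ D_i e_{τ-1}(λ without λ_i)`, with `e_j` the elementary symmetric polynomials and `D_i` the
eigenvalues of `B_τ`. Here `D_i` is a sum of `n - τ + 1` eigenvalues of `B` which include `λ_i`, and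
each product of `τ` eigenvalues contains one of them.
-/

namespace RCDVS

open Finset Matrix

section ElementarySymmetric

lemma esymm_cons_succ {R : Type*} [CommSemiring R] (a : R) (s : Multiset R) (k : ℕ) :
    (a ::ₘ s).esymm (k + 1) = s.esymm (k + 1) + a * s.esymm k := by
  simp only [Multiset.esymm, Multiset.powersetCard_cons, Multiset.map_add, Multiset.sum_add,
    Multiset.map_map, Function.comp_def, Multiset.prod_cons, Multiset.sum_map_mul_left]

variable {R : Type*} [CommSemiring R] [PartialOrder R] [IsOrderedRing R]

lemma esymm_nonneg {s : Multiset R} (hs : ∀ a ∈ s, 0 ≤ a) (k : ℕ) : 0 ≤ s.esymm k := by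
  refine Multiset.sum_nonneg fun x hx => ?_
  obtain ⟨t, ht, rfl⟩ := Multiset.mem_map.1 hx
  exact Multiset.prod_nonneg fun a ha =>
    hs a (Multiset.mem_of_le (Multiset.mem_powersetCard.1 ht).1 ha)

lemma esymm_le_esymm_cons {a : R} {s : Multiset R} (ha : 0 ≤ a) (hs : ∀ b ∈ s, 0 ≤ b) (k : ℕ) :
    s.esymm k ≤ (a ::ₘ s).esymm k := by
  cases k with
  | zero => simp [Multiset.esymm]
  | succ k =>
    rw [esymm_cons_succ]
    exact le_add_of_nonneg_right (mul_nonneg ha (esymm_nonneg hs k))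

lemma esymm_add_succ_le {u t : Multiset R} (hu : ∀ a ∈ u, 0 ≤ a) (ht : ∀ a ∈ t, 0 ≤ a) {k : ℕ}
    (hk : u.card ≤ k) : (u + t).esymm (k + 1) ≤ t.sum * (u + t).esymm k := by
  induction t using Multiset.induction_on with
  | empty => simp [Multiset.esymm, Multiset.powersetCard_eq_empty _ (Nat.lt_succ_of_le hk)]
  | cons a t ih =>
    obtain ⟨ha, ht⟩ := Multiset.forall_mem_cons.1 ht
    have hut : ∀ b ∈ u + t, 0 ≤ b := fun b hb => (Multiset.mem_add.1 hb).elim (hu b) (ht b)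
    rw [Multiset.add_cons, esymm_cons_succ, Multiset.sum_cons]
    calc (u + t).esymm (k + 1) + a * (u + t).esymm k
        ≤ t.sum * (u + t).esymm k + a * (u + t).esymm k := by gcongr; exact ih ht
      _ = (a + t.sum) * (u + t).esymm k := by ring
      _ ≤ (a + t.sum) * (a ::ₘ (u + t)).esymm k := by
          gcongr
          · exact add_nonneg ha (Multiset.sum_nonneg ht)
          · exact esymm_le_esymm_cons ha hut k

lemma esymm_succ_le_sum_mul_esymm_erase {ι : Type*} [Fintype ι] [DecidableEq ι] {d : ι → R}
    (hd : ∀ i, 0 ≤ d i) {T : Finset ι} {k : ℕ} (hk : Tᶜ.card ≤ k) {i : ι} (hi : i ∈ T) :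
    (univ.val.map d).esymm (k + 1) ≤ (∑ j ∈ T, d j) * ((univ.erase i).val.map d).esymm k := by
  set u := Tᶜ.val.map d with hu
  set t := (T.erase i).val.map d with ht
  have hnonneg (s : Finset ι) : ∀ a ∈ s.val.map d, 0 ≤ a := by simp [hd]
  have herase : (univ.erase i).val.map d = u + t := by
    have hdisj : Disjoint Tᶜ (T.erase i) := disjoint_compl_left.mono_right (erase_subset i T)
    rw [hu, ht, ← Multiset.map_add, ← disjUnion_val _ _ hdisj, disjUnion_eq_union]
    congr 2
    ext j
    simp only [mem_erase, mem_union, mem_compl, mem_univ]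
    grind
  have huniv : univ.val.map d = d i ::ₘ (u + t) := by
    rw [← herase, ← Multiset.map_cons, ← insert_val_of_notMem (notMem_erase i univ),
      insert_erase (mem_univ i)]
  have hsum : ∑ j ∈ T, d j = d i + t.sum := (add_sum_erase T d hi).symm
  rw [herase, huniv, esymm_cons_succ, hsum, add_mul, add_comm]
  gcongr
  exact esymm_add_succ_le (hnonneg _) (hnonneg _) (by simpa [u] using hk)

end ElementarySymmetric

section PrincipalMinors

lemma sum_powersetCard_succ_sum_erase {ι M : Type*} [DecidableEq ι] [AddCommMonoid M]
    (u : Finset ι) (k : ℕ) (F : ι → Finset ι → M) :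
    ∑ s ∈ u.powersetCard (k + 1), ∑ i ∈ s, F i (s.erase i) =
      ∑ i ∈ u, ∑ t ∈ (u.erase i).powersetCard k, F i t := by
  rw [sum_sigma', sum_sigma']
  refine sum_nbij' (fun p => ⟨p.2, p.1.erase p.2⟩) (fun p => ⟨insert p.1 p.2, p.1⟩)
    ?_ ?_ ?_ ?_ fun _ _ => rfl
  · rintro ⟨s, i⟩ h
    simp only [mem_sigma, mem_powersetCard] at h ⊢
    obtain ⟨⟨hsu, hcard⟩, hi⟩ := h
    exact ⟨hsu hi, erase_subset_erase i hsu, by rw [card_erase_of_mem hi, hcard]; rfl⟩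
  · rintro ⟨i, t⟩ h
    simp only [mem_sigma, mem_powersetCard, subset_erase] at h ⊢
    obtain ⟨hi, ⟨htu, hit⟩, hcard⟩ := h
    exact ⟨⟨insert_subset hi htu, by rw [card_insert_of_notMem hit, hcard]⟩,
      mem_insert_self i t⟩
  · rintro ⟨s, i⟩ h
    simp only [insert_erase (mem_sigma.1 h).2]
  · rintro ⟨i, t⟩ h
    have hit : i ∉ t := fun hit => notMem_erase i u ((mem_powersetCard.1 (mem_sigma.1 h).2).1 hit)
    simp only [erase_insert hit]

variable {ι R : Type*} [Fintype ι] [DecidableEq ι] [CommRing R]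

/-- The sum of all principal minors of order `k`: the normalizing constant of `k`-element volume
sampling and, up to sign, a coefficient of the characteristic polynomial. -/
def minorSum (A : Matrix ι ι R) (k : ℕ) : R :=
  ∑ s ∈ univ.powersetCard k, (A.submatrix (Subtype.val : s → ι) Subtype.val).det

/-- The quadratic form `v ↦ ∑ₛ ⟨adj(A_{s×s}) v_s, v_s⟩`, where `s` ranges over the sets of
cardinality `k`. As `adj(A_{s×s}) = det(A_{s×s}) (A_{s×s})⁻¹` for nonsingular `A_{s×s}`, this is
`minorSum A k` times the expectation of `⟨(A_{s×s})⁻¹ v_s, v_s⟩` under volume sampling. -/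
def volumeForm (A : Matrix ι ι R) (k : ℕ) (v : ι → R) : R :=
  ∑ s ∈ univ.powersetCard k,
    (fun i : s => v i) ⬝ᵥ (A.submatrix (Subtype.val : s → ι) Subtype.val).adjugate *ᵥ
      (fun i : s => v i)

lemma minorSum_conj {P Q : Matrix ι ι R} (hQP : Q * P = 1) (A : Matrix ι ι R) (k : ℕ) :
    minorSum (P * A * Q) k = minorSum A k := by
  rcases lt_or_ge (Fintype.card ι) k with hk | hk
  · rw [minorSum, minorSum, powersetCard_eq_empty.2 (by simpa using hk), sum_empty, sum_empty]
  · have hcharpoly : (P * A * Q).charpoly = A.charpoly := by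
      rw [charpoly_mul_comm, ← Matrix.mul_assoc, hQP, Matrix.one_mul]
    have hcoeff := charpoly_coeff_eq_sum_minors (P * A * Q) k hk
    rw [hcharpoly, charpoly_coeff_eq_sum_minors A k hk] at hcoeff
    exact ((isUnit_one.neg.pow k).mul_left_cancel hcoeff).symm

lemma adjugate_eq_det_smul_inv {A : Matrix ι ι R} (hA : IsUnit A.det) :
    A.adjugate = A.det • A⁻¹ := by
  rw [Matrix.inv_def, smul_smul, Ring.mul_inverse_cancel _ hA, one_smul]

lemma det_add_vecMulVec {A : Matrix ι ι R} (hA : IsUnit A.det) (u v : ι → R) :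
    (A + vecMulVec u v).det = A.det + v ⬝ᵥ A.adjugate *ᵥ u := by
  rw [vecMulVec_eq Unit, det_add_replicateCol_mul_replicateRow hA, Matrix.mul_assoc,
    ← replicateCol_mulVec, det_unique (1 + _ : Matrix Unit Unit R), Matrix.add_apply,
    replicateRow_mul_replicateCol_apply, one_apply_eq, mul_add, mul_one,
    adjugate_eq_det_smul_inv hA, smul_mulVec, dotProduct_smul, smul_eq_mul]

lemma minorSum_add_vecMulVec_self {A : Matrix ι ι R}
    (hA : ∀ s : Finset ι, IsUnit (A.submatrix (Subtype.val : s → ι) Subtype.val).det)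
    (v : ι → R) (k : ℕ) : minorSum (A + vecMulVec v v) k = minorSum A k + volumeForm A k v := by
  rw [minorSum, minorSum, volumeForm, ← sum_add_distrib]
  exact sum_congr rfl fun s _ => det_add_vecMulVec (hA s) _ _

lemma minorSum_diagonal (d : ι → R) (k : ℕ) :
    minorSum (diagonal d) k = (univ.val.map d).esymm k := by
  rw [esymm_map_val]
  refine sum_congr rfl fun s _ => ?_
  rw [submatrix_diagonal _ _ Subtype.val_injective, det_diagonal]
  exact prod_coe_sort s d

lemma volumeForm_diagonal (d : ι → R) (k : ℕ) (v : ι → R) :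
    volumeForm (diagonal d) (k + 1) v =
      ∑ i, v i ^ 2 * ((univ.erase i).val.map d).esymm k := by
  simp_rw [esymm_map_val, mul_sum]
  rw [← sum_powersetCard_succ_sum_erase univ k fun i t => v i ^ 2 * ∏ j ∈ t, d j]
  refine sum_congr rfl fun s _ => ?_
  rw [submatrix_diagonal _ _ Subtype.val_injective, adjugate_diagonal, dotProduct,
    ← sum_coe_sort s]
  refine sum_congr rfl fun i _ => ?_
  have hprod : ∏ j ∈ univ.erase i, d j = ∏ j ∈ s.erase i, d j := by
    have hmap : s.erase i = (univ.erase i).map (Function.Embedding.subtype (· ∈ s)) := by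
      ext j
      simp [and_comm]
    rw [hmap, prod_map]
    rfl
  rw [mulVec_diagonal, ← hprod]
  simp only [Function.comp_apply]
  ring

lemma minorSum_pos {A : Matrix ι ι ℝ} (hA : A.PosDef) {k : ℕ} (hk : k ≤ Fintype.card ι) :
    0 < minorSum A k :=
  sum_pos (fun _ _ => (hA.submatrix Subtype.val_injective).det_pos)
    (powersetCard_nonempty.2 hk)

lemma posDef_orthogonal_conj_iff {Q A : Matrix ι ι ℝ} (hQ : Q ∈ orthogonalGroup ι ℝ) :
    (Q * A * Qᵀ).PosDef ↔ A.PosDef :=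
  (Unitary.isUnit_coe (U := ⟨Q, hQ⟩)).posDef_star_right_conjugate_iff

lemma volumeForm_orthogonal_conj {Q A : Matrix ι ι ℝ} (hQ : Q ∈ orthogonalGroup ι ℝ)
    (hA : A.PosDef) (k : ℕ) (v : ι → ℝ) :
    volumeForm (Q * A * Qᵀ) k v = volumeForm A k (Qᵀ *ᵥ v) := by
  have hQQt : Q * Qᵀ = 1 := (mem_orthogonalGroup_iff ι ℝ).1 hQ
  have hQtQ : Qᵀ * Q = 1 := (mem_orthogonalGroup_iff' ι ℝ).1 hQ
  have hunit {M : Matrix ι ι ℝ} (hM : M.PosDef) (s : Finset ι) :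
      IsUnit (M.submatrix (Subtype.val : s → ι) Subtype.val).det :=
    (hM.submatrix Subtype.val_injective).det_pos.ne'.isUnit
  have hconj : (Q * A * Qᵀ).PosDef := (posDef_orthogonal_conj_iff hQ).2 hA
  have hrank : Q * A * Qᵀ + vecMulVec v v =
      Q * (A + vecMulVec (Qᵀ *ᵥ v) (Qᵀ *ᵥ v)) * Qᵀ := by
    rw [Matrix.mul_add, Matrix.add_mul, mul_vecMulVec, vecMulVec_mul, mulVec_mulVec, hQQt,
      vecMul_transpose, mulVec_mulVec, hQQt, one_mulVec]
  have hsum := minorSum_add_vecMulVec_self (hunit hconj) v k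
  rw [hrank, minorSum_conj hQtQ, minorSum_conj hQtQ,
    minorSum_add_vecMulVec_self (hunit hA)] at hsum
  exact (add_left_cancel hsum).symm

end PrincipalMinors

section CoordApprox

lemma dotProduct_inv_orthogonal_conj_diagonal {ι : Type*} [Fintype ι] [DecidableEq ι]
    {Q : Matrix ι ι ℝ} (hQ : Q ∈ orthogonalGroup ι ℝ) {d : ι → ℝ} (hd : ∀ i, d i ≠ 0)
    (v : ι → ℝ) :
    v ⬝ᵥ (Q * diagonal d * Qᵀ)⁻¹ *ᵥ v = ∑ i, (Qᵀ *ᵥ v) i ^ 2 / d i := by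
  have hQQt : Q * Qᵀ = 1 := (mem_orthogonalGroup_iff ι ℝ).1 hQ
  have hQtQ : Qᵀ * Q = 1 := (mem_orthogonalGroup_iff' ι ℝ).1 hQ
  have hdiag : diagonal d * diagonal d⁻¹ = 1 := by
    rw [diagonal_mul_diagonal, ← diagonal_one]
    exact congrArg diagonal (funext fun i => mul_inv_cancel₀ (hd i))
  have hinv : (Q * diagonal d * Qᵀ)⁻¹ = Q * diagonal d⁻¹ * Qᵀ := inv_eq_right_inv <|
    calc Q * diagonal d * Qᵀ * (Q * diagonal d⁻¹ * Qᵀ)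
        = Q * (diagonal d * (Qᵀ * Q) * diagonal d⁻¹) * Qᵀ := by simp only [Matrix.mul_assoc]
      _ = 1 := by rw [hQtQ, Matrix.mul_one, hdiag, Matrix.mul_one, hQQt]
  rw [hinv, ← mulVec_mulVec, ← mulVec_mulVec, dotProduct_mulVec, ← mulVec_transpose, dotProduct]
  refine sum_congr rfl fun i _ => ?_
  rw [mulVec_diagonal, Pi.inv_apply]
  ring

lemma minorSum_mul_dotProduct_inv_le_volumeForm {ι : Type*} [Fintype ι] [DecidableEq ι]
    {Q : Matrix ι ι ℝ} (hQ : Q ∈ orthogonalGroup ι ℝ) {d D : ι → ℝ} (hd : ∀ i, 0 < d i)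
    (hD : ∀ i, 0 < D i) {k : ℕ}
    (hdD : ∀ i, (univ.val.map d).esymm (k + 1) ≤ D i * ((univ.erase i).val.map d).esymm k)
    (v : ι → ℝ) :
    minorSum (Q * diagonal d * Qᵀ) (k + 1) * (v ⬝ᵥ (Q * diagonal D * Qᵀ)⁻¹ *ᵥ v) ≤
      volumeForm (Q * diagonal d * Qᵀ) (k + 1) v := by
  rw [minorSum_conj ((mem_orthogonalGroup_iff' ι ℝ).1 hQ), minorSum_diagonal,
    volumeForm_orthogonal_conj hQ (PosDef.diagonal hd), volumeForm_diagonal,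
    dotProduct_inv_orthogonal_conj_diagonal hQ fun i => (hD i).ne', mul_sum]
  refine sum_le_sum fun i _ => ?_
  rw [mul_div_left_comm]
  gcongr
  exact (div_le_iff₀' (hD i)).2 (hdD i)

variable {n : ℕ}

/-- The eigenvalue of `coordApprox Q lam τ` for the `i`-th column of `Q`. -/
def coordApproxEigenvalue (lam : Fin n → ℝ) (τ : ℕ) (i : Fin n) : ℝ :=
  lam ⟨min i (τ - 1), (min_le_left _ _).trans_lt i.isLt⟩ + ∑ j : Fin n with τ ≤ j.val, lam j

lemma coordApproxEigenvalue_pos {lam : Fin n → ℝ} (hlam : ∀ i, 0 < lam i) (τ : ℕ) (i : Fin n) :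
    0 < coordApproxEigenvalue lam τ i :=
  add_pos_of_pos_of_nonneg (hlam _) (sum_nonneg fun j _ => (hlam j).le)

lemma coordApprox_eq {Q : Matrix (Fin n) (Fin n) ℝ} (hQ : Q ∈ orthogonalGroup (Fin n) ℝ)
    (lam : Fin n → ℝ) (τ : ℕ) :
    coordApprox Q lam τ = Q * diagonal (coordApproxEigenvalue lam τ) * Qᵀ := by
  have hQQt : Q * Qᵀ = 1 := (mem_orthogonalGroup_iff _ ℝ).1 hQ
  have hdiag : diagonal (coordApproxEigenvalue lam τ) =
      diagonal (fun i : Fin n => lam ⟨min i (τ - 1), (min_le_left _ _).trans_lt i.isLt⟩) +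
        (∑ j : Fin n with τ ≤ j.val, lam j) • (1 : Matrix (Fin n) (Fin n) ℝ) := by
    rw [smul_one_eq_diagonal, diagonal_add]
    rfl
  rw [hdiag, Matrix.mul_add, Matrix.add_mul, Matrix.mul_smul, Matrix.smul_mul, Matrix.mul_one,
    hQQt]
  rfl

lemma coordApprox_posDef {Q : Matrix (Fin n) (Fin n) ℝ} (hQ : Q ∈ orthogonalGroup (Fin n) ℝ)
    {lam : Fin n → ℝ} (hlam : ∀ i, 0 < lam i) (τ : ℕ) : (coordApprox Q lam τ).PosDef := by
  rw [coordApprox_eq hQ, posDef_orthogonal_conj_iff hQ]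
  exact PosDef.diagonal (coordApproxEigenvalue_pos hlam τ)

lemma esymm_succ_le_coordApproxEigenvalue_mul {lam : Fin n → ℝ} (hlam : ∀ i, 0 ≤ lam i) (k : ℕ)
    (i : Fin n) :
    (univ.val.map lam).esymm (k + 1) ≤
      coordApproxEigenvalue lam (k + 1) i * ((univ.erase i).val.map lam).esymm k := by
  set a : Fin n := ⟨min i k, (min_le_left _ _).trans_lt i.isLt⟩
  set tail : Finset (Fin n) := {j | k + 1 ≤ j.val} with htail
  have ha_le : a.val ≤ k := min_le_right _ _
  have ha_tail : a ∉ tail := by simpa [htail] using ha_le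
  have hi : i ∈ insert a tail := by
    rcases le_or_gt i.val k with hik | hik
    · exact mem_insert.2 (Or.inl (Fin.ext (min_eq_left hik).symm))
    · exact mem_insert_of_mem (by simpa [htail] using hik)
  have hcard : (insert a tail)ᶜ.card ≤ k := by
    have hcompl : (insert a tail)ᶜ = ({j | j.val < k + 1} : Finset (Fin n)).erase a := by
      ext j
      simp [htail]
    rw [hcompl, card_erase_of_mem (by simpa using ha_le), Fin.card_filter_val_lt]
    omega
  have hsum : coordApproxEigenvalue lam (k + 1) i = ∑ j ∈ insert a tail, lam j :=
    (sum_insert ha_tail).symm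
  rw [hsum]
  exact esymm_succ_le_sum_mul_esymm_erase hlam hcard hi

lemma minorSum_mul_dotProduct_inv_coordApprox_le {Q : Matrix (Fin n) (Fin n) ℝ}
    (hQ : Q ∈ orthogonalGroup (Fin n) ℝ) {lam : Fin n → ℝ} (hlam : ∀ i, 0 < lam i) {τ : ℕ}
    (hτ : 1 ≤ τ) (v : Fin n → ℝ) :
    minorSum (Q * diagonal lam * Qᵀ) τ * (v ⬝ᵥ (coordApprox Q lam τ)⁻¹ *ᵥ v) ≤
      volumeForm (Q * diagonal lam * Qᵀ) τ v := by
  obtain ⟨k, rfl⟩ := Nat.exists_eq_add_of_le' hτ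
  rw [coordApprox_eq hQ]
  exact minorSum_mul_dotProduct_inv_le_volumeForm hQ hlam (coordApproxEigenvalue_pos hlam _)
    (esymm_succ_le_coordApproxEigenvalue_mul (fun i => (hlam i).le) k) v

end CoordApprox

section Optimization

open scoped MatrixOrder in
lemma exists_pos_mul_dotProduct_self_le {ι : Type*} [Fintype ι] {A : Matrix ι ι ℝ}
    (hA : A.PosDef) : ∃ c : ℝ, 0 < c ∧ ∀ v : ι → ℝ, c * (v ⬝ᵥ v) ≤ v ⬝ᵥ A *ᵥ v := by
  classical
  cases isEmpty_or_nonempty ι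
  · exact ⟨1, one_pos, fun v => by simp [dotProduct]⟩
  obtain ⟨c, hc, hcA⟩ := (CFC.exists_pos_algebraMap_le_iff hA.isHermitian.isSelfAdjoint).2
    fun _ hx => hA.isStrictlyPositive.spectrum_pos hx
  refine ⟨c, hc, fun v => ?_⟩
  have hnonneg := (Matrix.le_iff.1 hcA).dotProduct_mulVec_nonneg v
  rwa [Algebra.algebraMap_eq_smul_one, star_trivial, sub_mulVec, smul_mulVec, one_mulVec,
    dotProduct_sub, dotProduct_smul, smul_eq_mul, sub_nonneg] at hnonneg

lemma fenchel_young_dotProduct {ι : Type*} [Fintype ι] [DecidableEq ι] {A : Matrix ι ι ℝ}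
    (hA : A.PosDef) (g z : ι → ℝ) :
    -(2 * (g ⬝ᵥ z)) ≤ g ⬝ᵥ A⁻¹ *ᵥ g + z ⬝ᵥ A *ᵥ z := by
  set u := A⁻¹ *ᵥ g with hu
  have hAu : A *ᵥ u = g := by
    rw [hu, mulVec_mulVec, mul_nonsing_inv _ hA.det_pos.ne'.isUnit, one_mulVec]
  have hsymm : u ⬝ᵥ A *ᵥ z = g ⬝ᵥ z := by
    rw [dotProduct_mulVec, ← mulVec_transpose, ← conjTranspose_eq_transpose_of_trivial,
      hA.isHermitian.eq, hAu]
  have hsq : (z + u) ⬝ᵥ A *ᵥ (z + u) = z ⬝ᵥ A *ᵥ z + 2 * (g ⬝ᵥ z) + g ⬝ᵥ u := by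
    rw [mulVec_add, hAu, add_dotProduct, dotProduct_add, dotProduct_add, hsymm,
      dotProduct_comm z g, dotProduct_comm u g]
    ring
  have hnonneg := hA.posSemidef.dotProduct_mulVec_nonneg (z + u)
  rw [star_trivial, hsq] at hnonneg
  linarith

variable {n : ℕ}

lemma matNorm_sq {A : Matrix (Fin n) (Fin n) ℝ} (hA : A.PosSemidef)
    (v : EuclideanSpace ℝ (Fin n)) : matNorm A v ^ 2 = v.ofLp ⬝ᵥ A *ᵥ v.ofLp := by
  rw [matNorm, dotProduct_comm, Real.sq_sqrt]
  exact hA.dotProduct_mulVec_nonneg v.ofLp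

lemma real_inner_eq_dotProduct (v w : EuclideanSpace ℝ (Fin n)) :
    inner ℝ v w = v.ofLp ⬝ᵥ w.ofLp := by
  rw [EuclideanSpace.inner_eq_star_dotProduct, dotProduct_comm, star_trivial]

variable {f : EuclideanSpace ℝ (Fin n) → ℝ} {m : ℝ}

lemma IsStronglyConvex.exists_isLeast {A : Matrix (Fin n) (Fin n) ℝ} (hA : A.PosDef)
    (hm : IsStronglyConvex A m f) : ∃ fmin, IsLeast (Set.range f) fmin := by
  obtain ⟨hdiff, hm0, hconv⟩ := hm
  obtain ⟨c, hc, hcA⟩ := exists_pos_mul_dotProduct_self_le hA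
  have hlow (y : EuclideanSpace ℝ (Fin n)) :
      f 0 + ‖y‖ * (m / 2 * c * ‖y‖ - ‖gradient f 0‖) ≤ f y := by
    have hy := hconv 0 y
    rw [sub_zero, matNorm_sq hA.posSemidef] at hy
    have hinner := neg_le_of_abs_le (abs_real_inner_le_norm (gradient f 0) y)
    have hquad : c * ‖y‖ ^ 2 ≤ y.ofLp ⬝ᵥ A *ᵥ y.ofLp := by
      rw [← real_inner_self_eq_norm_sq, real_inner_eq_dotProduct]
      exact hcA y.ofLp
    linarith [mul_le_mul_of_nonneg_left hquad (half_pos hm0).le]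
  have hcoercive : Filter.Tendsto f (Filter.cocompact _) Filter.atTop := by
    refine Filter.tendsto_atTop_mono hlow (Filter.tendsto_atTop_add_const_left _ _ ?_)
    have hnorm := tendsto_norm_cocompact_atTop (E := EuclideanSpace ℝ (Fin n))
    refine hnorm.atTop_mul_atTop₀ ?_
    simp only [sub_eq_add_neg]
    exact Filter.tendsto_atTop_add_const_right _ _ (hnorm.const_mul_atTop (by positivity))
  obtain ⟨x, hx⟩ := hdiff.continuous.exists_forall_le hcoercive
  exact ⟨f x, Set.mem_range_self x, Set.forall_mem_range.2 hx⟩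

lemma IsStronglyConvex.mul_sub_le {A : Matrix (Fin n) (Fin n) ℝ} (hA : A.PosDef)
    (hm : IsStronglyConvex A m f) (x y : EuclideanSpace ℝ (Fin n)) :
    m * (f x - f y) ≤ 1 / 2 * ((gradient f x).ofLp ⬝ᵥ A⁻¹ *ᵥ (gradient f x).ofLp) := by
  obtain ⟨-, hm0, hconv⟩ := hm
  have hy := hconv x y
  rw [matNorm_sq hA.posSemidef, real_inner_eq_dotProduct] at hy
  have hyoung := fenchel_young_dotProduct hA (gradient f x).ofLp (m • (y - x).ofLp)
  simp only [mulVec_smul, dotProduct_smul, smul_dotProduct, smul_eq_mul] at hyoung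
  linarith [mul_le_mul_of_nonneg_left hy hm0.le]

lemma principal_posDef {B : Matrix (Fin n) (Fin n) ℝ} (hB : B.PosDef) (S : Finset (Fin n)) :
    (principal B S).PosDef :=
  hB.submatrix Subtype.val_injective

lemma colSelect_transpose_mulVec (S : Finset (Fin n)) (v : Fin n → ℝ) :
    (colSelect S)ᵀ *ᵥ v = fun i : S => v i := by
  ext i
  simp [colSelect, mulVec, dotProduct, one_apply]

lemma colSelect_transpose_mul_mul_colSelect (B : Matrix (Fin n) (Fin n) ℝ) (S : Finset (Fin n)) :
    (colSelect S)ᵀ * B * colSelect S = principal B S := by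
  ext i j
  simp [colSelect, mul_apply, one_apply, principal]

lemma IsOneSmooth.step_le {B : Matrix (Fin n) (Fin n) ℝ} (hB : B.PosDef) (hf : IsOneSmooth B f)
    (S : Finset (Fin n)) (x : EuclideanSpace ℝ (Fin n)) :
    f (step f B S x) ≤ f x - 1 / 2 * ((fun i : S => gradient f x i) ⬝ᵥ
      (principal B S)⁻¹ *ᵥ (fun i : S => gradient f x i)) := by
  set g : S → ℝ := fun i => gradient f x i
  set u : S → ℝ := (principal B S)⁻¹ *ᵥ g with hu
  have hBu : principal B S *ᵥ u = g := by
    rw [hu, mulVec_mulVec, mul_nonsing_inv _ (principal_posDef hB S).det_pos.ne'.isUnit,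
      one_mulVec]
  have hstep : (step f B S x - x).ofLp = -(colSelect S *ᵥ u) := by
    rw [step, sub_sub_cancel_left]
    rfl
  have hquad : matNorm B (step f B S x - x) ^ 2 = g ⬝ᵥ u := by
    rw [matNorm_sq hB.posSemidef, hstep, mulVec_neg, neg_dotProduct_neg, dotProduct_comm,
      dotProduct_mulVec, ← mulVec_transpose, mulVec_mulVec, mulVec_mulVec,
      colSelect_transpose_mul_mul_colSelect, hBu]
  have hinner : inner ℝ (gradient f x) (step f B S x - x) = -(g ⬝ᵥ u) := by
    rw [real_inner_eq_dotProduct, hstep, dotProduct_neg, dotProduct_mulVec, ← mulVec_transpose,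
      colSelect_transpose_mulVec]
  have hsmooth := hf.2 x (step f B S x)
  rw [hquad, hinner] at hsmooth
  linarith

end Optimization

section Sampling

variable {n τ : ℕ} {B : Matrix (Fin n) (Fin n) ℝ} {f : EuclideanSpace ℝ (Fin n) → ℝ}

/-- The conditional expectation `E[f(x_{k+1}) | x_k = x]` of the objective after one iteration. -/
noncomputable def stepMean (f : EuclideanSpace ℝ (Fin n) → ℝ) (B : Matrix (Fin n) (Fin n) ℝ) (τ : ℕ)
    (x : EuclideanSpace ℝ (Fin n)) : ℝ :=
  ∑ T : CoordSet n τ, (principal B T.val).det / (∑ T' : CoordSet n τ, (principal B T'.val).det) *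
    f (step f B T.val x)

lemma sum_coordSet (F : Finset (Fin n) → ℝ) :
    ∑ T : CoordSet n τ, F T.val = ∑ s ∈ univ.powersetCard τ, F s :=
  (sum_subtype _ (fun _ => mem_powersetCard_univ) F).symm

lemma minorSum_mul_stepMean_le (hτn : τ ≤ n) (hB : B.PosDef) (hf : IsOneSmooth B f)
    (x : EuclideanSpace ℝ (Fin n)) :
    minorSum B τ * stepMean f B τ x ≤
      minorSum B τ * f x - 1 / 2 * volumeForm B τ (gradient f x).ofLp := by
  have hpos : 0 < minorSum B τ := minorSum_pos hB (by simpa using hτn)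
  have hmean : minorSum B τ * stepMean f B τ x =
      ∑ s ∈ univ.powersetCard τ, (principal B s).det * f (step f B s x) := by
    rw [stepMean, sum_coordSet fun s => (principal B s).det,
      sum_coordSet fun s => (principal B s).det / _ * f (step f B s x), mul_sum]
    refine sum_congr rfl fun s _ => ?_
    change minorSum B τ * ((principal B s).det / minorSum B τ * f (step f B s x)) = _
    field_simp
  rw [hmean, minorSum, volumeForm, sum_mul, mul_sum, ← sum_sub_distrib]
  refine sum_le_sum fun s _ => ?_
  have hdet : 0 < (principal B s).det := (principal_posDef hB s).det_pos
  change _ ≤ (principal B s).det * f x - 1 / 2 * (_ ⬝ᵥ (principal B s).adjugate *ᵥ _)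
  rw [adjugate_eq_det_smul_inv hdet.ne'.isUnit, smul_mulVec, dotProduct_smul, smul_eq_mul]
  linarith [mul_le_mul_of_nonneg_left (hf.step_le hB s x) hdet.le]

lemma stepMean_sub_le (hτn : τ ≤ n) (hB : B.PosDef) (hf : IsOneSmooth B f)
    {A : Matrix (Fin n) (Fin n) ℝ} (hA : A.PosDef)
    (hAB : ∀ v, minorSum B τ * (v ⬝ᵥ A⁻¹ *ᵥ v) ≤ volumeForm B τ v) {m : ℝ}
    (hm : IsStronglyConvex A m f) (x y : EuclideanSpace ℝ (Fin n)) :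
    stepMean f B τ x - f y ≤ (1 - m) * (f x - f y) := by
  have hpos : 0 < minorSum B τ := minorSum_pos hB (by simpa using hτn)
  refine le_of_mul_le_mul_left ?_ hpos
  linarith [minorSum_mul_stepMean_le hτn hB hf x, hAB (gradient f x).ofLp,
    mul_le_mul_of_nonneg_left (hm.mul_sub_le hA x y) hpos.le]

end Sampling

section Expectation

variable {Ω : Type*} [MeasurableSpace Ω] {P : Measure Ω}

lemma integrable_comp_of_finite [IsFiniteMeasure P] {α : Type*} [MeasurableSpace α] [Finite α]
    [MeasurableSingletonClass α] {X : Ω → α} (hX : Measurable X) (F : α → ℝ) :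
    Integrable (fun ω => F (X ω)) P :=
  (Integrable.of_finite (μ := P.map X) (f := F)).comp_measurable hX

lemma integral_comp_of_indepFun [IsFiniteMeasure P] {α β : Type*} [MeasurableSpace α] [Finite α]
    [MeasurableSingletonClass α] [MeasurableSpace β] [Fintype β] [MeasurableSingletonClass β]
    {X : Ω → α} {Y : Ω → β} (hX : Measurable X) (hY : Measurable Y) (h : IndepFun X Y P)
    (F : α → β → ℝ) :
    ∫ ω, F (X ω) (Y ω) ∂P = ∫ ω, ∑ b, P.real {ω' | Y ω' = b} * F (X ω) b ∂P :=
  calc ∫ ω, F (X ω) (Y ω) ∂P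
      = ∫ p, F p.1 p.2 ∂P.map (fun ω => (X ω, Y ω)) :=
        (integral_map (hX.prodMk hY).aemeasurable
          (Integrable.of_finite (f := fun p : α × β => F p.1 p.2)).aestronglyMeasurable).symm
    _ = ∫ a, ∫ b, F a b ∂P.map Y ∂P.map X := by
        rw [(indepFun_iff_map_prod_eq_prod_map_map hX.aemeasurable hY.aemeasurable).1 h]
        exact integral_prod _ Integrable.of_finite
    _ = ∫ ω, ∫ b, F (X ω) b ∂P.map Y ∂P :=
        integral_map hX.aemeasurable Integrable.of_finite.aestronglyMeasurable
    _ = ∫ ω, ∑ b, P.real {ω' | Y ω' = b} * F (X ω) b ∂P := by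
        simp only [integral_fintype Integrable.of_finite, smul_eq_mul,
          map_measureReal_apply hY (measurableSet_singleton _)]
        rfl

instance (n τ : ℕ) : MeasurableSingletonClass (CoordSet n τ) := ⟨fun _ => trivial⟩

/-- The indices of the sets drawn before the `k`-th iterate is formed. -/
abbrev past {K : ℕ} (k : Fin (K + 1)) : Finset (Fin K) := {j | j.castSucc < k}

variable {n τ K : ℕ} {f : EuclideanSpace ℝ (Fin n) → ℝ} {B : Matrix (Fin n) (Fin n) ℝ}
  {x0 : EuclideanSpace ℝ (Fin n)} {S : Fin K → Ω → CoordSet n τ}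
  {x : Fin (K + 1) → Ω → EuclideanSpace ℝ (Fin n)}

lemma IsRCDVS.measurable_past (hx : IsRCDVS f B x0 P S x) (k : Fin (K + 1)) :
    Measurable fun ω (j : past k) => S j ω :=
  measurable_pi_lambda _ fun j => (hx.sampling j).1

lemma IsRCDVS.exists_eq_comp_past (hx : IsRCDVS f B x0 P S x) (k : Fin (K + 1)) :
    ∃ G : (past k → CoordSet n τ) → EuclideanSpace ℝ (Fin n),
      ∀ ω, x k ω = G fun j => S j ω := by
  induction k using Fin.induction with
  | zero => exact ⟨fun _ => x0, hx.init⟩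
  | succ k ih =>
    obtain ⟨G, hG⟩ := ih
    have hpast : past k.castSucc ⊆ past k.succ :=
      monotone_filter_right _ fun _ _ hj => hj.trans Fin.castSucc_lt_succ
    exact ⟨fun t => step f B (t ⟨k, by simp⟩).val (G fun j => t ⟨j, hpast j.2⟩),
      fun ω => by rw [hx.next, hG]⟩

lemma IsRCDVS.integrable [IsFiniteMeasure P] (hx : IsRCDVS f B x0 P S x) (k : Fin (K + 1))
    (F : EuclideanSpace ℝ (Fin n) → ℝ) : Integrable (fun ω => F (x k ω)) P := by
  obtain ⟨G, hG⟩ := hx.exists_eq_comp_past k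
  simp_rw [hG]
  exact integrable_comp_of_finite (hx.measurable_past k) fun t => F (G t)

lemma IsRCDVS.indepFun_past (hx : IsRCDVS f B x0 P S x) (k : Fin K) :
    IndepFun (fun ω (j : past k.castSucc) => S j ω) (S k) P :=
  (hx.indep.indepFun_finset (past k.castSucc) {k} (by simp) fun j => (hx.sampling j).1).comp
    measurable_id
    (measurable_pi_apply (⟨k, mem_singleton_self k⟩ : ({k} : Finset (Fin K))))

lemma IsRCDVS.integral_succ [IsFiniteMeasure P] (hx : IsRCDVS f B x0 P S x) (k : Fin K) :
    ∫ ω, f (x k.succ ω) ∂P = ∫ ω, stepMean f B τ (x k.castSucc ω) ∂P := by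
  obtain ⟨G, hG⟩ := hx.exists_eq_comp_past k.castSucc
  simp_rw [stepMean, hx.next, hG, ← (hx.sampling k).2]
  exact integral_comp_of_indepFun (hx.measurable_past k.castSucc) (hx.sampling k).1
    (hx.indepFun_past k) fun t T => f (step f B T.val (G t))

lemma IsRCDVS.integral_succ_sub_le [IsProbabilityMeasure P] (hx : IsRCDVS f B x0 P S x)
    {a q : ℝ} (hq : ∀ z, stepMean f B τ z - a ≤ q * (f z - a)) (k : Fin K) :
    (∫ ω, f (x k.succ ω) ∂P) - a ≤ q * ((∫ ω, f (x k.castSucc ω) ∂P) - a) := by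
  have hmono := integral_mono (hx.integrable k.castSucc fun z => stepMean f B τ z - a)
    (hx.integrable k.castSucc fun z => q * (f z - a)) fun ω => hq (x k.castSucc ω)
  rwa [integral_sub (hx.integrable k.castSucc (stepMean f B τ)) (integrable_const a),
    integral_const_mul, integral_sub (hx.integrable k.castSucc f) (integrable_const a),
    integral_const, probReal_univ, one_smul, ← hx.integral_succ] at hmono

end Expectation

lemma le_pow_mul_of_succ_le {K : ℕ} {a : Fin (K + 1) → ℝ} {q : ℝ} (ha : ∀ k, 0 ≤ a k)
    (hq : ∀ k : Fin K, a k.succ ≤ q * a k.castSucc) (k : Fin (K + 1)) :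
    a k ≤ q ^ k.val * a 0 := by
  rcases le_or_gt 0 q with hq0 | hq0
  · induction k using Fin.induction with
    | zero => simp
    | succ k ih =>
      calc a k.succ ≤ q * a k.castSucc := hq k
        _ ≤ q * (q ^ k.castSucc.val * a 0) := mul_le_mul_of_nonneg_left ih hq0
        _ = q ^ k.succ.val * a 0 := by rw [← mul_assoc, ← pow_succ']; rfl
  · have hzero (j : Fin K) : a j.castSucc = 0 :=
      le_antisymm (nonpos_of_mul_nonneg_right ((ha _).trans (hq j)) hq0) (ha _)
    cases k using Fin.cases with
    | zero => simp
    | succ k =>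
      have h0 : a 0 = 0 := by
        have : NeZero K := ⟨k.pos.ne'⟩
        exact hzero 0
      simpa [hzero k, h0] using hq k

end RCDVS

theorem theorem3p8_general {n τ K : ℕ} (hτ : 1 ≤ τ) (hτn : τ ≤ n)
    {B : Matrix (Fin n) (Fin n) ℝ} (hB : B.PosDef)
    {Q : Matrix (Fin n) (Fin n) ℝ} (hQ : Q ∈ Matrix.orthogonalGroup (Fin n) ℝ) {lam : Fin n → ℝ}
    (hBQ : B = Q * Matrix.diagonal lam * Q.transpose)
    {f : EuclideanSpace ℝ (Fin n) → ℝ} (hf : RCDVS.IsOneSmooth B f)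
    {μτ : ℝ} (hμ : RCDVS.IsStronglyConvex (RCDVS.coordApprox Q lam τ) μτ f)
    {x0 : EuclideanSpace ℝ (Fin n)}
    {Ω : Type*} [MeasurableSpace Ω] {P : Measure Ω} [IsProbabilityMeasure P]
    {S : Fin K → Ω → RCDVS.CoordSet n τ} {x : Fin (K + 1) → Ω → EuclideanSpace ℝ (Fin n)}
    (hx : RCDVS.IsRCDVS f B x0 P S x) :
    ∃ fmin : ℝ, IsLeast (Set.range f) fmin ∧
      ∀ k : Fin (K + 1),
        Integrable (fun ω => f (x k ω)) P ∧
          (∫ ω, f (x k ω) ∂P) - fmin ≤ (1 - μτ) ^ k.val * (f x0 - fmin) := by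
  have hlam : ∀ i, 0 < lam i := by
    rwa [hBQ, RCDVS.posDef_orthogonal_conj_iff hQ, Matrix.posDef_diagonal_iff] at hB
  have hA := RCDVS.coordApprox_posDef hQ hlam τ
  have hAB := RCDVS.minorSum_mul_dotProduct_inv_coordApprox_le hQ hlam hτ
  rw [← hBQ] at hAB
  obtain ⟨fmin, hmin⟩ := hμ.exists_isLeast hA
  obtain ⟨y, rfl⟩ := hmin.1
  have hcontract (k : Fin K) := hx.integral_succ_sub_le (k := k) fun z =>
    RCDVS.stepMean_sub_le hτn hB hf hA hAB hμ z y
  have hnonneg (k : Fin (K + 1)) : 0 ≤ (∫ ω, f (x k ω) ∂P) - f y := by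
    have hmono := integral_mono (integrable_const (f y)) (hx.integrable k f)
      fun ω => hmin.2 (Set.mem_range_self (x k ω))
    simpa using hmono
  refine ⟨f y, hmin, fun k => ⟨hx.integrable k f, ?_⟩⟩
  simpa [hx.init] using RCDVS.le_pow_mul_of_succ_le hnonneg hcontract k

theorem theorem3p8 {n τ K : ℕ} (hτ : 1 ≤ τ) (hτn : τ ≤ n) (hK : 1 ≤ K)
    (B : Matrix (Fin n) (Fin n) ℝ) (hB : B.PosDef)
    (Q : Matrix (Fin n) (Fin n) ℝ) (lam : Fin n → ℝ)
    (hQ : RCDVS.IsSpectralDecomposition B Q lam)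
    (f : EuclideanSpace ℝ (Fin n) → ℝ) (hf : RCDVS.IsOneSmooth B f)
    (μτ : ℝ) (hμ : RCDVS.IsStronglyConvex (RCDVS.coordApprox Q lam τ) μτ f)
    (x0 : EuclideanSpace ℝ (Fin n))
    {Ω : Type*} [MeasurableSpace Ω] (P : Measure Ω) [IsProbabilityMeasure P]
    (S : Fin K → Ω → RCDVS.CoordSet n τ) (x : Fin (K + 1) → Ω → EuclideanSpace ℝ (Fin n))
    (hx : RCDVS.IsRCDVS f B x0 P S x) :
    ∃ fmin : ℝ, IsLeast (Set.range f) fmin ∧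
      ∀ k : Fin (K + 1),
        Integrable (fun ω => f (x k ω)) P ∧
          (∫ ω, f (x k ω) ∂P) - fmin ≤ (1 - μτ) ^ k.val * (f x0 - fmin) :=
  theorem3p8_general hτ hτn hB hQ.orthogonal hQ.decomposition hf hμ hx
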